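/- Let $\Bbbk$ be a field and let $Q$ be a finite quiver with $n$ vertices, so that the path algebra $\Bbbk Q$ is hereditary. A representation $V$ of $Q$ means a finite-dimensional one; $\mathrm{Hom}$ and $\mathrm{Ext}^i$ are taken over $\Bbbk Q$, and $\mathrm{Ext}=\mathrm{Ext}^1$. $V$ is exceptional if $\mathrm{End}(V)$ is a division ring and $\mathrm{Ext}^i(V,V)=0$ for all $i\ge 1$. A complete exceptional sequence is a sequence $(E_1,\dots,E_n)$ of exceptional representations with $\mathrm{Hom}(E_i,E_j)=0=\mathrm{Ext}(E_i,E_j)$ for all $j<i$, and a complete exceptional set is a set $S$ of representations that can be ordered into a complete exceptional sequence. For a representation $V$, let ${}^{\perp}V$ be the full subcategory of representations $W$ with $\mathrm{Hom}(W,V)=0=\mathrm{Ext}(W,V)$. The term $E_i$ is called relatively injective in $(E_1,\dots,E_n)$ if $E_i$ is an injective object of the category ${}^{\perp}(E_1\oplus\cdots\oplus E_{i-1})$. Being relatively injective in a complete exceptional sequence is independent of the order: if $(E_1,\dots,E_n)$ and $(F_1,\dots,F_n)$ are complete exceptional sequences and $\sigma$ is a permutation with $F_i\cong E_{\sigma(i)}$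 for all $i$, then for every $i$, $F_i$ is relatively injective in $(F_1,\dots,F_n)$ if and only if $E_{\sigma(i)}$ is relatively injective in $(E_1,\dots,E_n)$. Consequently the relatively injective objects of a complete exceptional set $S$ form a well-defined subset: there is exactly one subset $R\subseteq S$ such that, for every ordering $(E_1,\dots,E_n)$ of $S$ into a complete exceptional sequence and every $i$, $E_i\in R$ if and only if $E_i$ is relatively injective in $(E_1,\dots,E_n)$. -/

import Mathlib

open CategoryTheory CategoryTheory.Limits

universe u

namespace ExcSeq

/-- The Ext-group `Extⁱ(X, Y)` of an abelian category vanishes. (The Ext-groups of an abelian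
category exist in a sufficiently large universe; their vanishing does not depend on it.) -/
def ExtVanishes {C : Type*} [Category C] [Abelian C] (X Y : C) (i : ℕ) : Prop :=
  letI := HasExt.standard C
  Subsingleton (Abelian.Ext X Y i)

/-- Representations over `k` of the quiver `Q`: a vector space at every vertex and a linear map
at every arrow, encoded as a functor from the free category on `Q`. This is the category of
modules over the path algebra `kQ` when `Q` is finite. -/
abbrev QuiverRep (k Q : Type u) [Field k] [Quiver.{u} Q] : Type (u + 1) :=
  Paths Q ⥤ ModuleCat.{u} k

section

variable {k Q : Type u} [Field k] [Quiver.{u} Q]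

/-- The representation is finite-dimensional (at every vertex; `Q` is finite in all uses). -/
def IsFinDim (V : QuiverRep k Q) : Prop :=
  ∀ x : Paths Q, Module.Finite k (V.obj x)

/-- `V` is a finite-dimensional representation whose endomorphism ring is a division ring and
which has no self-extensions in any positive degree. -/
structure IsExceptional (V : QuiverRep k Q) : Prop where
  finDim : IsFinDim V
  id_ne_zero : 𝟙 V ≠ 0
  isIso_of_ne_zero : ∀ f : V ⟶ V, f ≠ 0 → IsIso f
  ext_self : ∀ i : ℕ, 1 ≤ i → ExtVanishes V V i

/-- `(E 0, …, E (m - 1))` is an exceptional sequence. -/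
structure IsExceptionalSequence {m : ℕ} (E : Fin m → QuiverRep k Q) : Prop where
  exceptional : ∀ i, IsExceptional (E i)
  hom_eq_zero : ∀ i j, j < i → ∀ f : E i ⟶ E j, f = 0
  ext_vanishes : ∀ i j, j < i → ExtVanishes (E i) (E j) 1

/-- The left perpendicular category of `V`: finite-dimensional representations `W` with
`Hom(W, V) = 0 = Ext¹(W, V)`, as a full subcategory. -/
def leftPerp (V : QuiverRep k Q) : ObjectProperty (QuiverRep k Q) :=
  fun W => IsFinDim W ∧ (∀ f : W ⟶ V, f = 0) ∧ ExtVanishes W V 1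

/-- `M` is relatively injective with respect to `V`: it is an injective object of the left
perpendicular category of `V` (in particular, an object of it). -/
def IsRelInjectiveWrt (M V : QuiverRep k Q) : Prop :=
  ∃ h : leftPerp V M, Injective (⟨M, h⟩ : (leftPerp V).FullSubcategory)

/-- The `i`-th term of the sequence `E` is relatively injective in `E`, that is, with respect to
the direct sum of the terms that precede it. -/
noncomputable def IsRelInjectiveAt {m : ℕ} (E : Fin m → QuiverRep k Q) (i : Fin m) : Prop :=
  haveI : HasFiniteBiproducts (QuiverRep k Q) := Abelian.hasFiniteBiproducts
  IsRelInjectiveWrt (E i) (⨁ fun j : {j : Fin m // j < i} => E j.1)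

/-- The sequence `E`, indexed by as many places as `Q` has vertices, is an ordering of the set `S`
into a complete exceptional sequence. -/
def IsOrdering [Fintype Q] (S : Set (QuiverRep k Q)) (E : Fin (Fintype.card Q) → QuiverRep k Q) : Prop :=
  IsExceptionalSequence E ∧ Set.range E = S

/-- `S` is a complete exceptional set: it can be ordered into a complete exceptional sequence. -/
def IsCompleteExceptionalSet [Fintype Q] (S : Set (QuiverRep k Q)) : Prop :=
  ∃ E : Fin (Fintype.card Q) → QuiverRep k Q, IsOrdering S E

end

end ExcSeq

universe v w

namespace ExcSeq

/-! ### Short exact sequences and the vanishing of `Ext` -/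

section Extensions

open CategoryTheory.Abelian

variable {C : Type w} [Category.{v} C] [Abelian C]

/-! A term `M` is relatively injective exactly when `Ext¹(-, M)` vanishes on the left perpendicular
category of its predecessors (`isRelInjectiveWrt_iff`, `isRelInjectiveAt_iff`). Given two orderings,
it suffices to pass from the predecessors in the first to the common predecessors, since the latter
also precede `M` in the second.

The extra predecessors are discarded one at a time, latest first (`extVanishes_of_orderings`). Such
a `B` comes after `M` in the second ordering, so it is left orthogonal to `M` and to every
predecessor still kept. In `extVanishes_of_forall_isLeftOrthogonal`, a test object `W` is extended
by copies of `B` to kill `Ext¹(-, B)`, and the kernel of a universal map to copies of `B` then kills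
`Hom(-, B)` too. That kernel lies in the smaller perpendicular category, and vanishing of `Ext¹(-,
M)` travels back to `W`.

Heredity is used throughout. It holds because an extension of representations splits linearly at
each vertex, so it is given by an unconstrained family of linear maps, one per arrow. -/

lemma extVanishes_iff [HasExt.{max w v} C] {X Y : C} {i : ℕ} :
    ExtVanishes X Y i ↔ ∀ e : Ext.{max w v} X Y i, e = 0 :=
  ⟨fun h _ => @Subsingleton.elim _ h _ _, fun h => ⟨fun a b => (h a).trans (h b).symm⟩⟩

/-- Both `Hom(X, Y)` and `Ext¹(X, Y)` vanish. -/
def IsLeftOrthogonal (X Y : C) : Prop :=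
  (∀ f : X ⟶ Y, f = 0) ∧ ExtVanishes X Y 1

/-- `Ext¹` turns monomorphisms in its first argument into surjections, at the level of the
vanishing of these groups. -/
def ExtVanishesOnSubobjects (C : Type*) [Category C] [Abelian C] : Prop :=
  ∀ ⦃X Y Z : C⦄ (i : X ⟶ Y) [Mono i], ExtVanishes Y Z 1 → ExtVanishes X Z 1

/-- In an abelian category with enough injectives, every class in `Ext¹` is the class of a short
exact sequence. -/
lemma exists_extClass_eq [HasExt.{max w v} C] [EnoughInjectives C] {X Y : C}
    (e : Ext.{max w v} X Y 1) :
    ∃ (E : C) (f : Y ⟶ E) (g : E ⟶ X) (w : f ≫ g = 0)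
      (h : (ShortComplex.mk f g w).ShortExact), h.extClass = e := by
  let ι : Y ⟶ Injective.under Y := Injective.ι Y
  let T := ShortComplex.mk ι (cokernel.π ι) (cokernel.condition ι)
  have hT : T.ShortExact := { exact := ShortComplex.exact_cokernel ι }
  -- The class dies in `Ext¹(X, I)` for the injective `I`, so it comes from a map `φ : X ⟶ I/Y`; the
  -- extension sought is the pullback along `φ`.
  obtain ⟨x, hx⟩ := Ext.covariant_sequence_exact₁ X hT e (Ext.eq_zero_of_injective _) (zero_add 1)
  obtain ⟨φ : X ⟶ cokernel ι, rfl⟩ := (Ext.mk₀_bijective _ _).2 x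
  let i : Y ⟶ pullback φ (cokernel.π ι) := pullback.lift 0 ι (by simp)
  have hi : i ≫ pullback.fst _ _ = 0 := pullback.lift_fst _ _ _
  have hi' : i ≫ pullback.snd _ _ = ι := pullback.lift_snd _ _ _
  have : Mono i := mono_of_mono_fac hi'
  have hS : (ShortComplex.mk i (pullback.fst φ (cokernel.π ι)) hi).ShortExact :=
    { exact := by
        refine ShortComplex.exact_of_f_is_kernel _
          (KernelFork.IsLimit.ofι' _ _ fun {A} k hk => ?_)
        have hk' : (k ≫ pullback.snd φ (cokernel.π ι)) ≫ cokernel.π ι = 0 := by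
          rw [Category.assoc, ← pullback.condition, reassoc_of% hk, zero_comp]
        refine ⟨hT.exact.lift (k ≫ pullback.snd _ _) hk', ?_⟩
        apply pullback.hom_ext
        · simp [hi, hk]
        · rw [Category.assoc, hi']
          exact hT.exact.lift_f _ hk' }
  refine ⟨_, i, pullback.fst _ _, hi, hS, ?_⟩
  rw [← hx]
  simpa using ShortComplex.ShortExact.extClass_naturality hS hT
    { τ₁ := 𝟙 Y, τ₂ := pullback.snd _ _, τ₃ := φ, comm₁₂ := by simp [hi', T],
      comm₂₃ := by simp [T, pullback.condition] }

section

variable {S : ShortComplex C} (hS : S.ShortExact) {Y : C}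
include hS

lemma extVanishes_mid (h₁ : ExtVanishes S.X₁ Y 1) (h₃ : ExtVanishes S.X₃ Y 1) :
    ExtVanishes S.X₂ Y 1 := by
  have := HasExt.standard C
  rw [extVanishes_iff] at *
  intro e
  obtain ⟨x, rfl⟩ := Ext.contravariant_sequence_exact₂ hS Y e (h₁ _)
  rw [h₃ x, Ext.comp_zero]

lemma extVanishes_right (h₁ : ∀ f : S.X₁ ⟶ Y, f = 0) (h₂ : ExtVanishes S.X₂ Y 1) :
    ExtVanishes S.X₃ Y 1 := by
  have := HasExt.standard C
  rw [extVanishes_iff] at *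
  intro e
  obtain ⟨x, rfl⟩ := Ext.contravariant_sequence_exact₃ hS Y e (h₂ _) (add_zero 1)
  obtain ⟨φ, rfl⟩ := (Ext.mk₀_bijective _ _).2 x
  rw [h₁ φ, Ext.mk₀_zero, Ext.comp_zero]

lemma hom_eq_zero_right (h₂ : ∀ f : S.X₂ ⟶ Y, f = 0) (f : S.X₃ ⟶ Y) : f = 0 := by
  have := hS.epi_g
  rw [← cancel_epi S.g, h₂ (S.g ≫ f), comp_zero]

lemma hom_eq_zero_mid (h₁ : ∀ f : S.X₁ ⟶ Y, f = 0) (h₃ : ∀ f : S.X₃ ⟶ Y, f = 0)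
    (f : S.X₂ ⟶ Y) : f = 0 := by
  have := hS.epi_g
  rw [← hS.exact.g_desc f (h₁ _), h₃ (hS.exact.desc f (h₁ _)), comp_zero]

lemma exists_extension_of_extVanishes (h₃ : ExtVanishes S.X₃ Y 1) (f : S.X₁ ⟶ Y) :
    ∃ g : S.X₂ ⟶ Y, S.f ≫ g = f := by
  have := HasExt.standard C
  rw [extVanishes_iff] at h₃
  obtain ⟨x, hx⟩ := Ext.contravariant_sequence_exact₁ hS Y (Ext.mk₀ f) (add_zero 1) (h₃ _)
  obtain ⟨φ, rfl⟩ := (Ext.mk₀_bijective _ _).2 x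
  exact ⟨φ, (Ext.mk₀_bijective _ _).1 (by simpa using hx)⟩

lemma isLeftOrthogonal_mid (h₁ : IsLeftOrthogonal S.X₁ Y) (h₃ : IsLeftOrthogonal S.X₃ Y) :
    IsLeftOrthogonal S.X₂ Y :=
  ⟨hom_eq_zero_mid hS h₁.1 h₃.1, extVanishes_mid hS h₁.2 h₃.2⟩

lemma isLeftOrthogonal_right (h₁ : ∀ f : S.X₁ ⟶ Y, f = 0) (h₂ : IsLeftOrthogonal S.X₂ Y) :
    IsLeftOrthogonal S.X₃ Y :=
  ⟨hom_eq_zero_right hS h₂.1, extVanishes_right hS h₁ h₂.2⟩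

/-- A map `S.X₁ ⟶ Y` extends to `S.X₂`, where it must vanish; the `Ext¹` half is heredity. -/
lemma isLeftOrthogonal_left (H : ExtVanishesOnSubobjects C) (h₂ : IsLeftOrthogonal S.X₂ Y)
    (h₃ : ExtVanishes S.X₃ Y 1) : IsLeftOrthogonal S.X₁ Y := by
  have := hS.mono_f
  refine ⟨fun f => ?_, H S.f h₂.2⟩
  obtain ⟨g, rfl⟩ := exists_extension_of_extVanishes hS h₃ f
  rw [h₂.1 g, comp_zero]

end

lemma ExtVanishes.of_iso_right {X Y Y' : C} (α : Y ≅ Y') {i : ℕ} (h : ExtVanishes X Y i) :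
    ExtVanishes X Y' i := by
  have := HasExt.standard C
  rw [extVanishes_iff] at *
  intro e
  rw [← Ext.comp_mk₀_id e, ← α.inv_hom_id, ← Ext.mk₀_comp_mk₀,
    ← Ext.comp_assoc_of_third_deg_zero, h (e.comp _ _), Ext.zero_comp]

lemma ExtVanishes.of_iso_left {X X' Y : C} (α : X ≅ X') {i : ℕ} (h : ExtVanishes X Y i) :
    ExtVanishes X' Y i := by
  have := HasExt.standard C
  rw [extVanishes_iff] at *
  intro e
  rw [← Ext.mk₀_id_comp e, ← α.inv_hom_id, ← Ext.mk₀_comp_mk₀_assoc,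
    h ((Ext.mk₀ _).comp e _), Ext.comp_zero]

lemma IsLeftOrthogonal.of_iso {X X' Y Y' : C} (α : X ≅ X') (β : Y ≅ Y')
    (h : IsLeftOrthogonal X Y) : IsLeftOrthogonal X' Y' :=
  ⟨fun f => by simpa using h.1 (α.hom ≫ f ≫ β.inv), (h.2.of_iso_right β).of_iso_left α⟩

section

variable {J : Type*} [Fintype J] [HasFiniteBiproducts C]

lemma extVanishes_biproduct_right_iff (X : C) (Y : J → C) {i : ℕ} :
    ExtVanishes X (⨁ Y) i ↔ ∀ j, ExtVanishes X (Y j) i := by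
  have := HasExt.standard C
  let e := Ext.addEquivBiproduct X (biproduct.isBilimit Y) i
  simp_rw [extVanishes_iff]
  refine ⟨fun h j x => ?_, fun h x => e.injective (funext fun j => (h j _).trans (h j _).symm)⟩
  classical
  have := congrFun (congrArg e (h (e.symm (Pi.single j x)))) j
  simpa using this

lemma isLeftOrthogonal_biproduct_right_iff (X : C) (Y : J → C) :
    IsLeftOrthogonal X (⨁ Y) ↔ ∀ j, IsLeftOrthogonal X (Y j) := by
  classical
  simp only [IsLeftOrthogonal, extVanishes_biproduct_right_iff, forall_and]
  refine and_congr_left fun _ => ⟨fun h j f => ?_, fun h f => biproduct.hom_ext _ _ fun j => ?_⟩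
  · have := congrArg (· ≫ biproduct.π Y j) (h (f ≫ biproduct.ι Y j))
    simpa using this
  · rw [h j (f ≫ _), zero_comp]

lemma extVanishes_biproduct_left {X : J → C} {Y : C} {i : ℕ} (h : ∀ j, ExtVanishes (X j) Y i) :
    ExtVanishes (⨁ X) Y i := by
  have := HasExt.standard C
  simp_rw [extVanishes_iff] at *
  exact fun x => (Ext.biproductAddEquiv (biproduct.isBilimit X) Y i).injective
    (funext fun j => (h j _).trans (h j _).symm)

lemma isLeftOrthogonal_biproduct_left {X : J → C} {Y : C} (h : ∀ j, IsLeftOrthogonal (X j) Y) :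
    IsLeftOrthogonal (⨁ X) Y := by
  refine ⟨fun f => biproduct.hom_ext' _ _ fun j => ?_,
    extVanishes_biproduct_left fun j => (h j).2⟩
  rw [(h j).1 (_ ≫ f), comp_zero]

end

end Extensions

/-! ### Extensions of representations as cochains; heredity -/

section Cochains

open CategoryTheory.Abelian

variable {k Q : Type u} [Field k] [Quiver.{u} Q]

lemma enoughInjectives_quiverRep (k Q : Type u) [Field k] [Quiver.{u} Q] :
    EnoughInjectives (QuiverRep k Q) := by
  -- For the trivial topology every presheaf is a sheaf, so representations form a Grothendieck
  -- abelian category.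
  let e : Sheaf (⊥ : GrothendieckTopology (Paths Q)ᵒᵖ) (ModuleCat.{u} k) ≌ QuiverRep k Q :=
    (sheafBotEquivalence _).trans (opOpEquivalence (Paths Q)).congrLeft
  have := IsGrothendieckAbelian.of_equivalence.{u} e
  infer_instance

/-- A morphism of representations, from a family of linear maps compatible with the arrows. -/
def homOfArrows {V W : QuiverRep k Q}
    (φ : ∀ x : Q, V.obj ((Paths.of Q).obj x) ⟶ W.obj ((Paths.of Q).obj x))
    (h : ∀ (x y : Q) (a : x ⟶ y),
      V.map ((Paths.of Q).map a) ≫ φ y = φ x ≫ W.map ((Paths.of Q).map a)) : V ⟶ W where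
  app x := φ x
  naturality x y p := by
    let φ' : ∀ x : Paths Q, V.obj x ⟶ W.obj x := φ
    have h' (x y : Q) (a : x ⟶ y) : V.map ((Paths.of Q).map a) ≫ φ' ((Paths.of Q).obj y) =
      φ' ((Paths.of Q).obj x) ≫ W.map ((Paths.of Q).map a) := h x y a
    change V.map p ≫ φ' y = φ' x ≫ W.map p
    clear_value φ'
    induction p using Paths.induction_fixed_source with
    | id => simp
    | comp p q hp => rw [V.map_comp, W.map_comp, Category.assoc, h', reassoc_of% hp]

/-- A family of linear maps `X(x) → B(y)`, one for every arrow `x ⟶ y`. -/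
abbrev Cochain (X B : QuiverRep k Q) : Type u :=
  ∀ x y : Q, (x ⟶ y) → (X.obj ((Paths.of Q).obj x) →ₗ[k] B.obj ((Paths.of Q).obj y))

variable {X B : QuiverRep k Q} (c : Cochain X B)

namespace Cochain

/-- The space at the vertex `x` of the extension that a cochain defines. -/
abbrev vertex (_ : Cochain X B) (x : Q) : ModuleCat.{u} k :=
  ModuleCat.of k (B.obj ((Paths.of Q).obj x) × X.obj ((Paths.of Q).obj x))

/-- The arrow `a` acts on `B ⊕ X` by the block triangular matrix with the off-diagonal
entry `c a`. -/
noncomputable abbrev arrow {x y : Q} (a : x ⟶ y) : c.vertex x ⟶ c.vertex y :=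
  ModuleCat.ofHom
    (LinearMap.prod (LinearMap.coprod (B.map ((Paths.of Q).map a)).hom (c x y a))
      ((X.map ((Paths.of Q).map a)).hom ∘ₗ LinearMap.snd k _ _))

/-- The extension of `X` by `B` that a cochain defines. -/
noncomputable def middle : QuiverRep k Q :=
  Paths.lift { obj := c.vertex, map := fun a => c.arrow a }

lemma middle_map {x y : Q} (a : x ⟶ y) : c.middle.map ((Paths.of Q).map a) = c.arrow a :=
  Paths.lift_toPath _ _

/-- The inclusion of `B` into the extension. -/
noncomputable def inl : B ⟶ c.middle :=
  homOfArrows (V := B) (W := c.middle)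
    (fun x => (ModuleCat.ofHom (LinearMap.inl k _ _) : _ ⟶ c.vertex x)) fun x y a => by
      rw [c.middle_map]
      apply ModuleCat.hom_ext
      apply LinearMap.ext
      intro v
      change ((B.map ((Paths.of Q).map a)).hom v, (0 : X.obj ((Paths.of Q).obj y))) =
        ((B.map ((Paths.of Q).map a)).hom v + c x y a 0, (X.map ((Paths.of Q).map a)).hom 0)
      simp

/-- The projection of the extension onto `X`. -/
noncomputable def snd : c.middle ⟶ X :=
  homOfArrows (V := c.middle) (W := X)
    (fun x => (ModuleCat.ofHom (LinearMap.snd k _ _) : c.vertex x ⟶ _)) fun x y a => by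
      rw [c.middle_map]
      rfl

lemma inl_snd : c.inl ≫ c.snd = 0 := rfl

/-- The short complex `B ⟶ c.middle ⟶ X`. -/
noncomputable abbrev shortComplex : ShortComplex (QuiverRep k Q) :=
  ShortComplex.mk c.inl c.snd c.inl_snd

lemma inl_app_injective (x : Paths Q) : Function.Injective (c.inl.app x).hom :=
  fun _ _ h => congrArg (Prod.fst : B.obj x × X.obj x → B.obj x) h

lemma snd_app_surjective (x : Paths Q) : Function.Surjective (c.snd.app x).hom :=
  fun v => ⟨((0 : B.obj x), v), rfl⟩

lemma shortExact : c.shortComplex.ShortExact := by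
  have : Mono c.inl := by
    rw [NatTrans.mono_iff_mono_app]
    exact fun x => (ModuleCat.mono_iff_injective _).2 (c.inl_app_injective x)
  have : Epi c.snd := by
    rw [NatTrans.epi_iff_epi_app]
    exact fun x => (ModuleCat.epi_iff_surjective _).2 (c.snd_app_surjective x)
  refine .mk (ShortComplex.exact_of_f_is_kernel _
    (KernelFork.IsLimit.ofι' _ _ fun {A} φ hφ => ?_))
  have hφ' (x : Paths Q) (v : A.obj x) : ((φ.app x).hom v).2 = 0 :=
    congrArg (fun ψ : A ⟶ X => (ψ.app x).hom v) hφ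
  -- The first component commutes with the arrows because the off-diagonal entry only sees the
  -- second, which is zero.
  refine ⟨homOfArrows (V := A) (W := B)
    (fun x => ModuleCat.ofHom (LinearMap.fst k _ _ ∘ₗ (φ.app ((Paths.of Q).obj x)).hom))
      fun x y a => ?_, ?_⟩
  · apply ModuleCat.hom_ext
    apply LinearMap.ext
    intro v
    have h := congrArg (fun ψ => (ψ.hom v).1) (φ.naturality ((Paths.of Q).map a))
    rw [c.middle_map] at h
    have h₀ : c x y a ((φ.app ((Paths.of Q).obj x)).hom v).2 = 0 :=
      (congrArg (c x y a) (hφ' _ v)).trans (map_zero _)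
    let b : B.obj ((Paths.of Q).obj x) := ((φ.app ((Paths.of Q).obj x)).hom v).1
    exact h.trans ((congrArg ((B.map ((Paths.of Q).map a)).hom b + ·) h₀).trans (add_zero _))
  · ext x v
    exact Prod.ext rfl (hφ' x v).symm

/-- Compatible morphisms of the outer terms extend to the extensions defined by cochains. -/
noncomputable def map {X' B' : QuiverRep k Q} {c : Cochain X B} {c' : Cochain X' B'}
    (φ : B ⟶ B') (ψ : X ⟶ X')
    (h : ∀ (x y : Q) (a : x ⟶ y),
      (φ.app ((Paths.of Q).obj y)).hom ∘ₗ c x y a =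
        c' x y a ∘ₗ (ψ.app ((Paths.of Q).obj x)).hom) :
    c.middle ⟶ c'.middle :=
  homOfArrows (V := c.middle) (W := c'.middle)
    (fun x => (ModuleCat.ofHom (LinearMap.prodMap (φ.app ((Paths.of Q).obj x)).hom
      (ψ.app ((Paths.of Q).obj x)).hom) : c.vertex x ⟶ c'.vertex x)) fun x y a => by
    rw [c.middle_map, c'.middle_map]
    apply ModuleCat.hom_ext
    apply LinearMap.ext
    rintro ⟨b, v⟩
    have h₁ := congrArg (fun θ => θ.hom b) (φ.naturality ((Paths.of Q).map a))
    have h₂ := congrArg (fun θ => θ.hom v) (ψ.naturality ((Paths.of Q).map a))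
    refine Prod.ext ?_ h₂
    change (φ.app ((Paths.of Q).obj y)).hom ((B.map ((Paths.of Q).map a)).hom b + c x y a v) =
      (B'.map ((Paths.of Q).map a)).hom ((φ.app ((Paths.of Q).obj x)).hom b) +
        c' x y a ((ψ.app ((Paths.of Q).obj x)).hom v)
    rw [map_add]
    exact congrArg₂ (· + ·) h₁ (LinearMap.congr_fun (h x y a) v)

/-- With `φ` or `ψ` an identity, this says that composing cochains with morphisms induces pushout
and pullback of classes. -/
lemma extClass_comp_eq [HasExt.{w} (QuiverRep k Q)] {X' B' : QuiverRep k Q} {c : Cochain X B} {c' : Cochain X' B'}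
    (φ : B ⟶ B') (ψ : X ⟶ X')
    (h : ∀ (x y : Q) (a : x ⟶ y),
      (φ.app ((Paths.of Q).obj y)).hom ∘ₗ c x y a =
        c' x y a ∘ₗ (ψ.app ((Paths.of Q).obj x)).hom) :
    c.shortExact.extClass.comp (Ext.mk₀ φ) (add_zero 1) =
      (Ext.mk₀ ψ).comp c'.shortExact.extClass (zero_add 1) :=
  ShortComplex.ShortExact.extClass_naturality c.shortExact c'.shortExact
    { τ₁ := φ
      τ₂ := map φ ψ h
      τ₃ := ψ
      comm₁₂ := by
        ext x v
        exact (Prod.ext rfl (map_zero (ψ.app x).hom).symm :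
          ((φ.app x).hom v, (0 : X'.obj x)) = ((φ.app x).hom v, (ψ.app x).hom 0))
      comm₂₃ := rfl }

/-- Choose linear retractions `r` of `S.f` at the vertices. Their failure `d` to commute with the
arrows vanishes on `S.X₁`, so it descends to a cochain on `S.X₃`, and `(r, S.g)` compares the two
extensions. -/
lemma exists_extClass_eq_of_shortExact [HasExt.{w} (QuiverRep k Q)]
    {S : ShortComplex (QuiverRep k Q)} (hS : S.ShortExact) :
    ∃ c : Cochain S.X₃ S.X₁, c.shortExact.extClass = hS.extClass := by
  have := hS.mono_f
  have := hS.epi_g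
  have hf (x : Paths Q) : Function.Injective (S.f.app x).hom :=
    (ModuleCat.mono_iff_injective _).1 inferInstance
  have hg (x : Paths Q) : Function.Surjective (S.g.app x).hom :=
    (ModuleCat.epi_iff_surjective _).1 inferInstance
  have hex (x : Paths Q) (e : S.X₂.obj x) (he : (S.g.app x).hom e = 0) :
      ∃ b, (S.f.app x).hom b = e :=
    (ShortComplex.moduleCat_exact_iff _).1
      (hS.exact.map ((evaluation (Paths Q) (ModuleCat.{u} k)).obj x)) e he
  choose r hr using fun x => LinearMap.exists_leftInverse_of_injective (S.f.app x).hom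
    (LinearMap.ker_eq_bot.2 (hf x))
  choose s hs using fun x => LinearMap.exists_rightInverse_of_surjective (S.g.app x).hom
    (LinearMap.range_eq_top.2 (hg x))
  let d (x y : Q) (a : x ⟶ y) :
      S.X₂.obj ((Paths.of Q).obj x) →ₗ[k] S.X₁.obj ((Paths.of Q).obj y) :=
    r _ ∘ₗ (S.X₂.map ((Paths.of Q).map a)).hom - (S.X₁.map ((Paths.of Q).map a)).hom ∘ₗ r _
  let c : Cochain S.X₃ S.X₁ := fun x y a => d x y a ∘ₗ s _
  have hd (x y : Q) (a : x ⟶ y) (e : S.X₂.obj ((Paths.of Q).obj x)) :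
      c x y a ((S.g.app _).hom e) = d x y a e := by
    obtain ⟨b, hb⟩ := hex _ (e - s _ ((S.g.app _).hom e)) (by
      rw [map_sub, ← LinearMap.comp_apply, hs, LinearMap.id_apply, sub_self])
    have h₀ : d x y a ((S.f.app _).hom b) = 0 := by
      have h₁ := congrArg (fun θ => θ.hom b) (S.f.naturality ((Paths.of Q).map a))
      have h₂ := LinearMap.congr_fun (hr ((Paths.of Q).obj x)) b
      have h₃ := LinearMap.congr_fun (hr ((Paths.of Q).obj y))
        ((S.X₁.map ((Paths.of Q).map a)).hom b)
      simp only [LinearMap.comp_apply, LinearMap.id_apply] at h₂ h₃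
      simp only [d, LinearMap.sub_apply, LinearMap.comp_apply, h₂, sub_eq_zero]
      exact (congrArg (r _) h₁.symm).trans h₃
    rw [hb, map_sub, sub_eq_zero] at h₀
    exact h₀.symm
  refine ⟨c, ?_⟩
  let τ : S.X₂ ⟶ c.middle := homOfArrows (V := S.X₂) (W := c.middle)
    (fun x => (ModuleCat.ofHom (LinearMap.prod (r _) (S.g.app _).hom) :
      S.X₂.obj ((Paths.of Q).obj x) ⟶ c.vertex x)) fun x y a => by
    rw [c.middle_map]
    apply ModuleCat.hom_ext
    apply LinearMap.ext
    intro e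
    have h₂ := congrArg (fun θ => θ.hom e) (S.g.naturality ((Paths.of Q).map a))
    refine Prod.ext ?_ h₂
    change r _ ((S.X₂.map ((Paths.of Q).map a)).hom e) =
      (S.X₁.map ((Paths.of Q).map a)).hom (r _ e) + c x y a ((S.g.app _).hom e)
    rw [hd]
    simp [d]
  have h := ShortComplex.ShortExact.extClass_naturality hS c.shortExact
    { τ₁ := 𝟙 _
      τ₂ := τ
      τ₃ := 𝟙 _
      comm₁₂ := by
        ext x b
        refine Prod.ext (LinearMap.congr_fun (hr x) b).symm ?_
        exact congrArg (fun θ : S.X₁ ⟶ S.X₃ => (θ.app x).hom b) S.zero.symm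
      comm₂₃ := by
        ext x e
        rfl }
  simpa using h.symm

/-- Every class in `Ext¹` is defined by a cochain. -/
lemma exists_extClass_eq [HasExt.{u + 1} (QuiverRep k Q)] (e : Ext.{u + 1} X B 1) :
    ∃ c : Cochain X B, c.shortExact.extClass = e := by
  have := enoughInjectives_quiverRep k Q
  obtain ⟨E, f, g, hfg, hS, rfl⟩ := ExcSeq.exists_extClass_eq e
  exact exists_extClass_eq_of_shortExact hS

end Cochain

variable (k Q) in
/-- The category of representations of a quiver is hereditary. -/
lemma extVanishesOnSubobjects_quiverRep : ExtVanishesOnSubobjects (QuiverRep k Q) := by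
  intro X Y Z i _ h
  have := HasExt.standard (QuiverRep k Q)
  rw [extVanishes_iff] at *
  intro e
  obtain ⟨c, rfl⟩ := Cochain.exists_extClass_eq e
  have hi (x : Paths Q) : Function.Injective (i.app x).hom :=
    (ModuleCat.mono_iff_injective _).1 inferInstance
  choose r hr using fun x => LinearMap.exists_leftInverse_of_injective (i.app x).hom
    (LinearMap.ker_eq_bot.2 (hi x))
  -- Cochains satisfy no condition, so `c` extends from `X` to `Y` by linear algebra alone; its
  -- class is then a pullback from `Ext¹(Y, Z) = 0`.
  let c' : Cochain Y Z := fun x y a => c x y a ∘ₗ r _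
  have := Cochain.extClass_comp_eq (c := c) (c' := c') (𝟙 Z) i fun x y a => by
    simp only [c', LinearMap.comp_assoc, hr]
    rfl
  rwa [h c'.shortExact.extClass, Ext.comp_zero, Ext.comp_mk₀_id] at this

end Cochains

/-! ### Kernels in left perpendicular categories -/

section Kernels

open CategoryTheory.Abelian

variable {C : Type w} [Category.{v} C] [Abelian C]

lemma shortExact_kernel_image {X Y : C} (f : X ⟶ Y) :
    (ShortComplex.mk (kernel.ι f) (Abelian.factorThruImage f)
      (by rw [← cancel_mono (Abelian.image.ι f)]; simp)).ShortExact := by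
  let φ : ShortComplex.mk (kernel.ι f) (Abelian.factorThruImage f)
      (by rw [← cancel_mono (Abelian.image.ι f)]; simp) ⟶
      ShortComplex.mk (kernel.ι f) f (kernel.condition f) :=
    { τ₁ := 𝟙 _, τ₂ := 𝟙 _, τ₃ := Abelian.image.ι f }
  exact .mk ((ShortComplex.exact_iff_of_epi_of_isIso_of_mono φ).2 (ShortComplex.exact_kernel f))

lemma isLeftOrthogonal_kernel (H : ExtVanishesOnSubobjects C) {X Y V : C} (f : X ⟶ Y)
    (hX : IsLeftOrthogonal X V) (hY : ExtVanishes Y V 1) : IsLeftOrthogonal (kernel f) V :=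
  isLeftOrthogonal_left (shortExact_kernel_image f) H hX (H (Abelian.image.ι f) hY)

end Kernels

/-! ### Universal extensions and universal maps -/

section FiniteDimensional

open CategoryTheory.Abelian

variable {k Q : Type u} [Field k] [Quiver.{u} Q]

lemma IsFinDim.of_mono {V W : QuiverRep k Q} (i : V ⟶ W) [Mono i] (h : IsFinDim W) :
    IsFinDim V := fun x => by
  have := h x
  exact Module.Finite.of_injective (i.app x).hom
    ((ModuleCat.mono_iff_injective _).1 inferInstance)

lemma IsFinDim.of_epi {V W : QuiverRep k Q} (p : V ⟶ W) [Epi p] (h : IsFinDim V) :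
    IsFinDim W := fun x => by
  have := h x
  exact Module.Finite.of_surjective (p.app x).hom
    ((ModuleCat.epi_iff_surjective _).1 inferInstance)

lemma IsFinDim.biproduct {J : Type*} [Finite J] [HasFiniteBiproducts (QuiverRep k Q)]
    {V : J → QuiverRep k Q} (h : ∀ j, IsFinDim (V j)) : IsFinDim (⨁ V) := fun x => by
  have := fun j => h j x
  have := Fintype.ofFinite J
  let f : (⨁ V).obj x →ₗ[k] ∀ j, (V j).obj x :=
    LinearMap.pi fun j => ((biproduct.π V j).app x).hom
  refine Module.Finite.of_injective f (LinearMap.ker_eq_bot.1 (LinearMap.ker_eq_bot'.2 ?_))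
  intro v hv
  have h₁ (j : J) : ((biproduct.π V j).app x).hom v = 0 := congrFun hv j
  have h₀ : ∑ j, biproduct.π V j ≫ biproduct.ι V j = 𝟙 (⨁ V) :=
    IsBilimit.total (biproduct.isBilimit V)
  have h₂ := congrArg (fun θ => (θ.app x).hom v) h₀
  simpa [NatTrans.app_sum, ModuleCat.hom_sum, h₁] using h₂.symm

lemma IsFinDim.middle {X B : QuiverRep k Q} (c : Cochain X B) (hX : IsFinDim X)
    (hB : IsFinDim B) : IsFinDim c.middle := fun x => by
  have := hX x
  have := hB x
  exact (inferInstance : Module.Finite k (B.obj x × X.obj x))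

lemma finite_cochain [Finite Q] [∀ a b : Q, Finite (a ⟶ b)] {X B : QuiverRep k Q}
    (hX : IsFinDim X) (hB : IsFinDim B) : Module.Finite k (Cochain X B) := by
  have := fun x : Q => hX ((Paths.of Q).obj x)
  have := fun x : Q => hB ((Paths.of Q).obj x)
  infer_instance

lemma finite_hom [Finite Q] {X B : QuiverRep k Q}
    (hX : IsFinDim X) (hB : IsFinDim B) : Module.Finite k (X ⟶ B) := by
  have := fun x : Paths Q => hX x
  have := fun x : Paths Q => hB x
  have : Finite (Paths Q) := ‹Finite Q›
  let f : (X ⟶ B) →ₗ[k] ∀ x : Paths Q, X.obj x →ₗ[k] B.obj x :=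
    { toFun := fun φ x => (φ.app x).hom
      map_add' := fun _ _ => rfl
      map_smul' := fun _ _ => rfl }
  refine Module.Finite.of_injective f fun φ ψ h => ?_
  ext x : 2
  exact ModuleCat.hom_ext (congrFun h x)

variable [HasFiniteBiproducts (QuiverRep k Q)]

/-- A universal extension of `X` by a power of `B`. -/
lemma exists_cochain_extVanishes_middle [Finite Q] [∀ a b : Q, Finite (a ⟶ b)]
    {X B : QuiverRep k Q} (hX : IsFinDim X) (hB : IsFinDim B) (hBB : ExtVanishes B B 1) :
    ∃ (n : ℕ) (c : Cochain X (⨁ fun _ : Fin n => B)), ExtVanishes c.middle B 1 := by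
  have := finite_cochain hX hB
  have := HasExt.standard (QuiverRep k Q)
  obtain ⟨n, s, hs⟩ := Module.Finite.exists_fin (R := k) (M := Cochain X B)
  -- The components of `c` span all cochains, so every class in `Ext¹(X, B)` is a pushout of the
  -- class of `c` and dies when pulled back to `c.middle`.
  let c : Cochain X (⨁ fun _ : Fin n => B) := fun x y a =>
    ∑ j, ((biproduct.ι (fun _ : Fin n => B) j).app ((Paths.of Q).obj y)).hom ∘ₗ s j x y a
  refine ⟨n, c, extVanishes_iff.2 fun e => ?_⟩
  have hBn : ExtVanishes (⨁ fun _ : Fin n => B) B 1 := extVanishes_biproduct_left fun _ => hBB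
  obtain ⟨e, rfl⟩ := Ext.contravariant_sequence_exact₂ c.shortExact B e (extVanishes_iff.1 hBn _)
  obtain ⟨d, rfl⟩ := Cochain.exists_extClass_eq e
  obtain ⟨l, rfl⟩ := (Submodule.mem_span_range_iff_exists_fun k).1
    (hs ▸ Submodule.mem_top : d ∈ Submodule.span k (Set.range s))
  let φ : (⨁ fun _ : Fin n => B) ⟶ B := biproduct.desc fun j => l j • 𝟙 B
  have h := Cochain.extClass_comp_eq (c := c) (c' := ∑ j, l j • s j) φ (𝟙 X) fun x y a => by
    ext v
    have hι (j : Fin n) (b : B.obj ((Paths.of Q).obj y)) :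
        (φ.app ((Paths.of Q).obj y)).hom
          (((biproduct.ι (fun _ : Fin n => B) j).app ((Paths.of Q).obj y)).hom b) = l j • b :=
      congrArg (fun θ : B ⟶ B => (θ.app ((Paths.of Q).obj y)).hom b)
        (biproduct.ι_desc (fun j => l j • 𝟙 B) j)
    simp [c, hι]
  rw [Ext.mk₀_id_comp] at h
  rw [← h, ShortComplex.ShortExact.comp_extClass_assoc]

/-- A universal morphism from `X` to a power of `B`. -/
lemma exists_hom_biproduct_factors [Finite Q] {X B : QuiverRep k Q} (hX : IsFinDim X)
    (hB : IsFinDim B) :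
    ∃ (n : ℕ) (p : X ⟶ ⨁ fun _ : Fin n => B), ∀ f : X ⟶ B, ∃ g, p ≫ g = f := by
  have := finite_hom hX hB
  obtain ⟨n, s, hs⟩ := Module.Finite.exists_fin (R := k) (M := X ⟶ B)
  refine ⟨n, biproduct.lift s, fun f => ?_⟩
  obtain ⟨l, rfl⟩ := (Submodule.mem_span_range_iff_exists_fun k).1
    (hs ▸ Submodule.mem_top : f ∈ Submodule.span k (Set.range s))
  exact ⟨biproduct.desc fun j => l j • 𝟙 B, by simp [biproduct.lift_desc]⟩

/-- To test the vanishing of `Ext¹(-, A)` on the left perpendicular category of a class `S`, it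
suffices to test it on the left perpendicular category of `S` and `B`, where `B` is a rigid object
of the former that is left orthogonal to `A`. -/
lemma extVanishes_of_forall_isLeftOrthogonal [Finite Q] [∀ a b : Q, Finite (a ⟶ b)]
    {A B : QuiverRep k Q} {S : Set (QuiverRep k Q)} (hB : IsFinDim B) (hBB : ExtVanishes B B 1)
    (hBS : ∀ Y ∈ S, IsLeftOrthogonal B Y) (hBA : IsLeftOrthogonal B A)
    (h : ∀ W : QuiverRep k Q, IsFinDim W → (∀ Y ∈ insert B S, IsLeftOrthogonal W Y) →
      ExtVanishes W A 1)
    {W : QuiverRep k Q} (hW : IsFinDim W) (hWS : ∀ Y ∈ S, IsLeftOrthogonal W Y) :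
    ExtVanishes W A 1 := by
  have H := extVanishesOnSubobjects_quiverRep k Q
  obtain ⟨m, c, hc⟩ := exists_cochain_extVanishes_middle hW hB hBB
  have hcfin : IsFinDim c.middle := .middle c hW (.biproduct fun _ => hB)
  obtain ⟨n, p, hp⟩ := exists_hom_biproduct_factors hcfin hB
  -- Vanishing passes from `c.middle` to `W` since `Hom(B, A) = 0`, and to `c.middle` from the
  -- kernel and image of `p`, the image being a subobject of a power of `B`.
  refine extVanishes_right c.shortExact (isLeftOrthogonal_biproduct_left fun _ => hBA).1 ?_
  refine extVanishes_mid (shortExact_kernel_image p)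
    (h _ (.of_mono (kernel.ι p) hcfin) ?_) (H (Abelian.image.ι p)
      (extVanishes_biproduct_left fun _ => hBA.2))
  rintro Y (rfl | hY)
  -- A map from the kernel to `B` extends to `c.middle`, there factors through `p`, and so is zero
  -- on the kernel.
  · refine ⟨fun f => ?_, H (kernel.ι p) hc⟩
    obtain ⟨g, rfl⟩ := exists_extension_of_extVanishes (shortExact_kernel_image p)
      (H (Abelian.image.ι p) (extVanishes_biproduct_left fun _ => hBB)) f
    obtain ⟨g, rfl⟩ := hp g
    simp
  · exact isLeftOrthogonal_kernel H p (isLeftOrthogonal_mid c.shortExact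
      (isLeftOrthogonal_biproduct_left fun _ => hBS Y hY) (hWS Y hY))
      (extVanishes_biproduct_left fun _ => (hBS Y hY).2)

end FiniteDimensional

/-! ### Relative injectivity and change of ordering -/

section RelativeInjectivity

open CategoryTheory.Abelian

variable {k Q : Type u} [Field k] [Quiver.{u} Q]

lemma leftPerp_iff {V W : QuiverRep k Q} :
    leftPerp V W ↔ IsFinDim W ∧ IsLeftOrthogonal W V := Iff.rfl

/-- The injective objects of a left perpendicular category are the objects without nontrivial
extensions in it. -/
lemma isRelInjectiveWrt_iff {M V : QuiverRep k Q} :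
    IsRelInjectiveWrt M V ↔ leftPerp V M ∧ ∀ W, leftPerp V W → ExtVanishes W M 1 := by
  have H := extVanishesOnSubobjects_quiverRep k Q
  have := HasExt.standard (QuiverRep k Q)
  constructor
  · rintro ⟨hM, hinj⟩
    refine ⟨hM, fun W hW => extVanishes_iff.2 fun e => ?_⟩
    obtain ⟨c, rfl⟩ := Cochain.exists_extClass_eq e
    have hc : leftPerp V c.middle :=
      ⟨.middle c hW.1 hM.1, isLeftOrthogonal_mid c.shortExact hM.2 hW.2⟩
    let i : (⟨M, hM⟩ : (leftPerp V).FullSubcategory) ⟶ ⟨c.middle, hc⟩ :=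
      ObjectProperty.homMk c.inl
    have : Mono ((leftPerp V).ι.map i) := c.shortExact.mono_f
    have : Mono i := (leftPerp V).ι.mono_of_mono_map this
    obtain ⟨r, hr⟩ := hinj.factors (𝟙 _) i
    have hr' : c.inl ≫ r.hom = 𝟙 M := congrArg (fun φ => φ.hom) hr
    -- The retraction `r` splits the extension, so its class is zero.
    rw [← Ext.comp_mk₀_id c.shortExact.extClass]
    change c.shortExact.extClass.comp (Ext.mk₀ (𝟙 M)) _ = 0
    rw [← hr', ← Ext.mk₀_comp_mk₀]
    exact c.shortExact.extClass_comp_assoc _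
  · rintro ⟨hM, h⟩
    refine ⟨hM, ⟨fun {X Y} g f _ => ?_⟩⟩
    -- The perpendicular category contains kernels of its morphisms, so its monomorphisms are
    -- genuine ones.
    have : Mono f.hom := by
      have hK : leftPerp V (kernel f.hom) :=
        ⟨.of_mono (kernel.ι _) X.2.1, isLeftOrthogonal_kernel H _ X.2.2 Y.2.2.2⟩
      let i : (⟨_, hK⟩ : (leftPerp V).FullSubcategory) ⟶ X := ObjectProperty.homMk (kernel.ι f.hom)
      have hi : i = 0 := by
        rw [← cancel_mono f, zero_comp]
        ext1
        exact kernel.condition f.hom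
      exact Preadditive.mono_of_kernel_zero (congrArg (fun φ => φ.hom) hi)
    have hS : (ShortComplex.mk f.hom (cokernel.π f.hom) (cokernel.condition _)).ShortExact :=
      .mk (ShortComplex.exact_cokernel _)
    have hC : leftPerp V (cokernel f.hom) :=
      ⟨.of_epi (cokernel.π _) Y.2.1, isLeftOrthogonal_right hS X.2.2.1 Y.2.2⟩
    obtain ⟨r, hr⟩ := exists_extension_of_extVanishes hS (h _ hC) g.hom
    exact ⟨ObjectProperty.homMk r, by ext1; exact hr⟩

lemma IsExceptionalSequence.isLeftOrthogonal {m : ℕ} {E : Fin m → QuiverRep k Q}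
    (hE : IsExceptionalSequence E) {i j : Fin m} (h : j < i) : IsLeftOrthogonal (E i) (E j) :=
  ⟨hE.hom_eq_zero i j h, hE.ext_vanishes i j h⟩

lemma isRelInjectiveAt_iff {m : ℕ} {E : Fin m → QuiverRep k Q} (hE : IsExceptionalSequence E)
    (i : Fin m) : IsRelInjectiveAt E i ↔ ∀ W : QuiverRep k Q, IsFinDim W →
      (∀ j, j < i → IsLeftOrthogonal W (E j)) → ExtVanishes W (E i) 1 := by
  have : HasFiniteBiproducts (QuiverRep k Q) := Abelian.hasFiniteBiproducts
  simp only [IsRelInjectiveAt, isRelInjectiveWrt_iff, leftPerp_iff,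
    isLeftOrthogonal_biproduct_right_iff, Subtype.forall, and_imp]
  exact and_iff_right ⟨(hE.exceptional i).finDim, fun j h => hE.isLeftOrthogonal h⟩

/-- If a family of rigid objects is an exceptional sequence for two orderings, given by the rank
functions `p` and `q`, then `Ext¹(-, E m)` vanishes on the left perpendicular category of the
terms that precede `E m` in the first ordering as soon as it vanishes on that of those which
precede `E m` in either of them. -/
lemma extVanishes_of_orderings [Finite Q] [∀ a b : Q, Finite (a ⟶ b)] {ι : Type*} [Finite ι]
    {E : ι → QuiverRep k Q} (hfin : ∀ i, IsFinDim (E i)) (hrigid : ∀ i, ExtVanishes (E i) (E i) 1)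
    {α : Type*} [LinearOrder α] {p q : ι → α} (hq : Function.Injective q)
    (hp : Function.Injective p)
    (hpE : ∀ i j, p j < p i → IsLeftOrthogonal (E i) (E j))
    (hqE : ∀ i j, q j < q i → IsLeftOrthogonal (E i) (E j)) (m : ι)
    (h : ∀ W : QuiverRep k Q, IsFinDim W → (∀ j, p j < p m → IsLeftOrthogonal W (E j)) →
      ExtVanishes W (E m) 1)
    {W : QuiverRep k Q} (hW : IsFinDim W)
    (hWE : ∀ j, q j < q m → IsLeftOrthogonal W (E j)) : ExtVanishes W (E m) 1 := by
  classical
  have := Fintype.ofFinite ι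
  have : HasFiniteBiproducts (QuiverRep k Q) := Abelian.hasFiniteBiproducts
  let T : Set ι := {j | p j < p m ∧ q j < q m}
  have key (D : Finset ι) : (∀ j ∈ D, p j < p m ∧ q m < q j) →
      (∀ W : QuiverRep k Q, IsFinDim W → (∀ Y ∈ E '' (T ∪ D), IsLeftOrthogonal W Y) →
        ExtVanishes W (E m) 1) →
      ∀ W : QuiverRep k Q, IsFinDim W → (∀ Y ∈ E '' T, IsLeftOrthogonal W Y) →
        ExtVanishes W (E m) 1 := by
    -- Removing the `p`-largest element `a` first makes `E a` left orthogonal to the rest of `D` via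
    -- `p`; to `T` and `E m` it is so via `q`.
    induction D using Finset.induction_on_max_value p with
    | empty => simp
    | insert a s has hmax ih =>
      intro hD hs
      refine ih (fun j hj => hD j (Finset.mem_insert_of_mem hj)) fun W hW hWs => ?_
      have ha := hD a (Finset.mem_insert_self a s)
      refine extVanishes_of_forall_isLeftOrthogonal (hfin a) (hrigid a) ?_ (hqE _ _ ha.2) ?_ hW hWs
      · rintro _ ⟨j, hj | hj, rfl⟩
        · exact hqE _ _ (hj.2.trans ha.2)
        · exact hpE _ _ ((hmax j hj).lt_of_ne fun h => has (hp h ▸ hj))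
      · intro W hW hWs
        refine hs W hW ?_
        rwa [Finset.coe_insert, Set.union_insert, Set.image_insert_eq]
  refine key {j | p j < p m ∧ q m < q j} (by simp) (fun W hW hWS => h W hW fun j hj => ?_) W hW ?_
  · refine hWS _ ⟨j, ?_, rfl⟩
    rcases lt_trichotomy (q j) (q m) with h | h | h
    · exact Or.inl ⟨hj, h⟩
    · exact absurd (hq h ▸ hj) (lt_irrefl _)
    · exact Or.inr (by simpa using ⟨hj, h⟩)
  · rintro _ ⟨j, hj, rfl⟩
    exact hWE j hj.2

/-- Transported along the isomorphisms, `F` becomes the family `E` ranked by `σ.symm` instead of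
`id`; `extVanishes_of_orderings` applies in both directions. -/
lemma isRelInjectiveAt_iff_of_perm [Finite Q] [∀ a b : Q, Finite (a ⟶ b)] {n : ℕ}
    {E F : Fin n → QuiverRep k Q} (hE : IsExceptionalSequence E) (hF : IsExceptionalSequence F)
    (σ : Equiv.Perm (Fin n)) (hσ : ∀ i, Nonempty (F i ≅ E (σ i))) (i : Fin n) :
    IsRelInjectiveAt F i ↔ IsRelInjectiveAt E (σ i) := by
  have iso (j : Fin n) : Nonempty (F (σ.symm j) ≅ E j) := by simpa using hσ (σ.symm j)
  have hF' : IsRelInjectiveAt F i ↔ ∀ W : QuiverRep k Q, IsFinDim W →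
      (∀ j, σ.symm j < σ.symm (σ i) → IsLeftOrthogonal W (E j)) → ExtVanishes W (E (σ i)) 1 := by
    rw [isRelInjectiveAt_iff hF]
    obtain ⟨α⟩ := hσ i
    refine forall₂_congr fun W _ => imp_congr ?_ ⟨.of_iso_right α, .of_iso_right α.symm⟩
    rw [← σ.symm.forall_congr_right, Equiv.symm_apply_apply]
    refine forall₂_congr fun j _ => ?_
    obtain ⟨β⟩ := iso j
    exact ⟨.of_iso (.refl _) β, .of_iso (.refl _) β.symm⟩
  have hE₂ (a b : Fin n) (h : σ.symm b < σ.symm a) : IsLeftOrthogonal (E a) (E b) := by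
    obtain ⟨α⟩ := iso a
    obtain ⟨β⟩ := iso b
    exact (hF.isLeftOrthogonal h).of_iso α β
  have hfin := fun j => (hE.exceptional j).finDim
  have hrigid := fun j => (hE.exceptional j).ext_self 1 le_rfl
  rw [hF', isRelInjectiveAt_iff hE]
  exact ⟨fun h W => extVanishes_of_orderings (q := id) hfin hrigid Function.injective_id
      σ.symm.injective hE₂ (fun _ _ => hE.isLeftOrthogonal) (σ i) h,
    fun h W => extVanishes_of_orderings (p := id) hfin hrigid σ.symm.injective
      Function.injective_id (fun _ _ => hE.isLeftOrthogonal) hE₂ (σ i) h⟩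

lemma IsExceptionalSequence.injective {m : ℕ} {E : Fin m → QuiverRep k Q}
    (hE : IsExceptionalSequence E) : Function.Injective E := by
  have key {i j : Fin m} (h : j < i) : E i ≠ E j := fun e =>
    (hE.exceptional i).id_ne_zero (by
      have := hE.hom_eq_zero i j h
      rw [← e] at this
      exact this _)
  intro i j h
  rcases lt_trichotomy i j with h' | h' | h'
  · exact absurd h.symm (key h')
  · exact h'
  · exact absurd h (key h')

/-- The terms of an exceptional sequence are distinct, so two orderings of one set differ by a
permutation. -/
lemma IsOrdering.isRelInjectiveAt_iff [Fintype Q] [∀ a b : Q, Finite (a ⟶ b)]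
    {S : Set (QuiverRep k Q)} {E F : Fin (Fintype.card Q) → QuiverRep k Q} (hE : IsOrdering S E)
    (hF : IsOrdering S F) {i j : Fin (Fintype.card Q)} (h : F i = E j) :
    IsRelInjectiveAt F i ↔ IsRelInjectiveAt E j := by
  let σ : Equiv.Perm (Fin (Fintype.card Q)) := (Equiv.ofInjective F hF.1.injective).trans
    ((Equiv.setCongr (hF.2.trans hE.2.symm)).trans (Equiv.ofInjective E hE.1.injective).symm)
  have hσ (i) : E (σ i) = F i := Equiv.apply_ofInjective_symm hE.1.injective _
  obtain rfl : σ i = j := hE.1.injective ((hσ i).trans h)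
  exact isRelInjectiveAt_iff_of_perm hE.1 hF.1 σ (fun i => ⟨eqToIso (hσ i).symm⟩) i

end RelativeInjectivity

end ExcSeq

theorem mainTheorem4 {k : Type u} [Field k] {Q : Type u} [Quiver.{u} Q] [Fintype Q]
    [∀ a b : Q, Finite (a ⟶ b)] :
    (∀ E F : Fin (Fintype.card Q) → ExcSeq.QuiverRep k Q,
      ExcSeq.IsExceptionalSequence E → ExcSeq.IsExceptionalSequence F →
      ∀ σ : Equiv.Perm (Fin (Fintype.card Q)), (∀ i, Nonempty (F i ≅ E (σ i))) →
      ∀ i, ExcSeq.IsRelInjectiveAt F i ↔ ExcSeq.IsRelInjectiveAt E (σ i)) ∧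
    (∀ S : Set (ExcSeq.QuiverRep k Q), ExcSeq.IsCompleteExceptionalSet S →
      ∃! R : Set (ExcSeq.QuiverRep k Q), R ⊆ S ∧
        ∀ E : Fin (Fintype.card Q) → ExcSeq.QuiverRep k Q, ExcSeq.IsOrdering S E →
          ∀ i, E i ∈ R ↔ ExcSeq.IsRelInjectiveAt E i) := by
  refine ⟨fun E F hE hF σ hσ i => ExcSeq.isRelInjectiveAt_iff_of_perm hE hF σ hσ i, ?_⟩
  rintro S ⟨E, hE⟩
  -- One chosen ordering `E` defines the subset; order independence makes every other ordering agree
  -- with it.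
  refine ⟨{X | ∃ i, E i = X ∧ ExcSeq.IsRelInjectiveAt E i}, ⟨?_, fun F hF i => ?_⟩, ?_⟩
  · rintro _ ⟨i, rfl, _⟩
    exact hE.2 ▸ Set.mem_range_self i
  · constructor
    · rintro ⟨j, hj, h⟩
      exact (hE.isRelInjectiveAt_iff hF hj.symm).2 h
    · intro h
      obtain ⟨j, hj⟩ : F i ∈ Set.range E := hE.2 ▸ hF.2 ▸ Set.mem_range_self i
      exact ⟨j, hj, (hE.isRelInjectiveAt_iff hF hj.symm).1 h⟩
  · rintro R ⟨hRS, hR⟩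
    ext X
    constructor
    · intro hX
      obtain ⟨i, rfl⟩ : X ∈ Set.range E := hE.2 ▸ hRS hX
      exact ⟨i, rfl, (hR E hE i).1 hX⟩
    · rintro ⟨i, rfl, h⟩
      exact (hR E hE i).2 h
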